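/- Let $R>0$ and let $|\cdot|$ be the Euclidean norm on $\mathbb R^2$; write $B(x,\rho)=\{y\in\mathbb R^2:|y-x|<\rho\}$ and $S^1=\{v\in\mathbb R^2:|v|=1\}$. Let $A\subset\mathbb R^2$ be an $R$-body, that is, a nonempty closed set such that every point $y\in\mathbb R^2\setminus A$ lies in some open ball of radius $R$ that is disjoint from $A$. For $a\in\partial A$ let $$\mathcal N_R(A,a)=\{v\in S^1:\ A\cap B(a+Rv,R)=\emptyset\}.$$ A set $\mathcal K\subset S^1$ is called spherically convex if $\mathcal K=\mathrm{co}(K)\cap S^1$, where $K=\{\lambda v: v\in\mathcal K,\ \lambda\ge 0\}$ and $\mathrm{co}$ denotes the convex hull. If $\mathcal N_R(A,a)$ is spherically convex for every $a\in\partial A$, then $\mathrm{reach}(A)\ge R$. Here $\mathrm{reach}(A)=\inf_{a\in A}\mathrm{reach}(A,a)\in[0,\infty]$, where $\mathrm{reach}(A,a)$ is the supremum of all $\rho>0$ such that every $x\in B(a,\rho)$ has a unique nearest point in $A$ (and $\mathrm{reach}(A,a)=0$ if there is no such $\rho$). -/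

import Mathlib

open scoped ENNReal

namespace RBodies

/-- A body: a nonempty closed subset of Euclidean space. -/
def IsBody {d : ℕ} (A : Set (EuclideanSpace ℝ (Fin d))) : Prop :=
  A.Nonempty ∧ IsClosed A

/-- An `R`-body: a body each of whose exterior points lies in an open ball of radius `R`
contained in the complement. -/
def IsRBody {d : ℕ} (R : ℝ) (A : Set (EuclideanSpace ℝ (Fin d))) : Prop :=
  IsBody A ∧ ∀ y ∈ Aᶜ, ∃ c, y ∈ Metric.ball c R ∧ Metric.ball c R ⊆ Aᶜ

/-- `𝒩_R(A, a)`: the unit vectors `v` such that the open ball of radius `R` centred at `a + R v`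
does not meet `A`. -/
def supportingVectors {d : ℕ} (R : ℝ) (A : Set (EuclideanSpace ℝ (Fin d)))
    (a : EuclideanSpace ℝ (Fin d)) : Set (EuclideanSpace ℝ (Fin d)) :=
  {v | v ∈ Metric.sphere 0 1 ∧ A ⊆ (Metric.ball (a + R • v) R)ᶜ}

/-- The cone `{t v : v ∈ K, t ≥ 0}` related to a subset `K` of the unit sphere. -/
def relatedCone {d : ℕ} (K : Set (EuclideanSpace ℝ (Fin d))) :
    Set (EuclideanSpace ℝ (Fin d)) :=
  {x | ∃ v ∈ K, ∃ t : ℝ, 0 ≤ t ∧ x = t • v}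

/-- The spherical convex hull of a subset `K` of the unit sphere. -/
def sphericalHull {d : ℕ} (K : Set (EuclideanSpace ℝ (Fin d))) :
    Set (EuclideanSpace ℝ (Fin d)) :=
  convexHull ℝ (relatedCone K) ∩ Metric.sphere 0 1

/-- A subset of the unit sphere is spherically convex if it is its own spherical convex hull. -/
def IsSphericallyConvex {d : ℕ} (K : Set (EuclideanSpace ℝ (Fin d))) : Prop :=
  sphericalHull K = K

/-- `Unp(A)`: the points having a unique nearest point in `A`. -/
def unp {d : ℕ} (A : Set (EuclideanSpace ℝ (Fin d))) : Set (EuclideanSpace ℝ (Fin d)) :=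
  {x | ∃! b, b ∈ A ∧ dist b x = Metric.infDist x A}

/-- `reach(A, a)`, the supremum of the `ρ > 0` with `B(a, ρ) ⊆ Unp(A)`, in `[0, ∞]`
(it is `0` if there is no such `ρ`). -/
noncomputable def reachAt {d : ℕ} (A : Set (EuclideanSpace ℝ (Fin d)))
    (a : EuclideanSpace ℝ (Fin d)) : ℝ≥0∞ :=
  sSup {s | ∃ ρ : ℝ, 0 < ρ ∧ Metric.ball a ρ ⊆ unp A ∧ s = ENNReal.ofReal ρ}

/-- `reach(A)`, the infimum of `reach(A, a)` over `a ∈ A`. -/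
noncomputable def reach {d : ℕ} (A : Set (EuclideanSpace ℝ (Fin d))) : ℝ≥0∞ :=
  ⨅ a ∈ A, reachAt A a

end RBodies

/-!
Call `v ∈ 𝒩_R(A, a)` a supporting direction of radius `R` at `a`. If `b` is a nearest point of `x`
and `r := dist b x < R`, then the direction from `b` to `x` is supporting of radius `r`. Were it
supporting of radius `R`, the larger tangent ball would contain every other point of the sphere of
radius `r` about `x`, so `b` would be the only nearest point. It therefore suffices that
`𝒩_r(A, a) ⊆ 𝒩_R(A, a)` for all `r > 0`.

Suppose `u ∈ 𝒩_r(A, a)` is not in `N := 𝒩_R(A, a)`. As `N` is spherically convex, some unit vector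
`w` satisfies `⟪w, u⟫ > 0 ≥ ⟪w, v⟫` for all `v ∈ N`. The points `a + t w` with small `t > 0` lie in
the ball touching `a` in direction `u`, hence outside `A`, hence in balls of radius `R` missing `A`.
As `t → 0`, the centres `a + e` of these balls accumulate at some `a + R v` with `v ∈ N`, and
`⟪w, e⟫ > 0` forces `v ⟂ w`. The directions `ν = e / ‖e‖` are not in `N`, so `A` meets the thin lune
between the balls of radius `R` about `a + R ν` and `a + R v`. In the plane, these points of `A` are
forced to converge to `a`, asymptotically in direction `w`, and so to enter the ball of radius `r`
about `a + r u`: a contradiction.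
-/

open Filter Topology Metric
open NormedSpace (normalize norm_normalize norm_smul_normalize normalize_smul_of_pos
  normalize_eq_self_of_norm_eq_one)
open scoped InnerProductSpace Pointwise

namespace RBodies

section InnerProductSpace

variable {E : Type*} [NormedAddCommGroup E] [InnerProductSpace ℝ E] {p e u w : E} {r R t : ℝ}

theorem norm_sub_smul_sq (hu : ‖u‖ = 1) (p : E) (r : ℝ) :
    ‖p - r • u‖ ^ 2 = ‖p‖ ^ 2 - 2 * r * ⟪u, p⟫_ℝ + r ^ 2 := by
  rw [norm_sub_sq_real, real_inner_smul_right, norm_smul, hu, mul_one, Real.norm_eq_abs, sq_abs,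
    real_inner_comm]
  ring

theorem norm_sub_smul_lt_iff (hr : 0 ≤ r) (hu : ‖u‖ = 1) :
    ‖p - r • u‖ < r ↔ ‖p‖ ^ 2 < 2 * r * ⟪u, p⟫_ℝ := by
  rw [← pow_lt_pow_iff_left₀ (norm_nonneg _) hr two_ne_zero, norm_sub_smul_sq hu]
  constructor <;> intro h <;> linarith

theorem le_norm_sub_smul_iff (hr : 0 ≤ r) (hu : ‖u‖ = 1) :
    r ≤ ‖p - r • u‖ ↔ 2 * r * ⟪u, p⟫_ℝ ≤ ‖p‖ ^ 2 := by
  simpa only [not_lt] using (norm_sub_smul_lt_iff (p := p) hr hu).not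

theorem norm_sub_smul_eq_iff (hr : 0 ≤ r) (hu : ‖u‖ = 1) :
    ‖p - r • u‖ = r ↔ ‖p‖ ^ 2 = 2 * r * ⟪u, p⟫_ℝ := by
  rw [← pow_left_inj₀ (norm_nonneg _) hr two_ne_zero, norm_sub_smul_sq hu]
  constructor <;> intro h <;> linarith

theorem norm_sub_smul_lt_of_internally_tangent (hr : 0 < r) (hrR : r < R) (hu : ‖u‖ = 1)
    (hp0 : p ≠ 0) (hp : ‖p - r • u‖ = r) : ‖p - R • u‖ < R := by
  rw [norm_sub_smul_eq_iff hr.le hu] at hp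
  have hup : 0 < ⟪u, p⟫_ℝ :=
    pos_of_mul_pos_right (hp ▸ pow_pos (norm_pos_iff.2 hp0) 2) (by positivity)
  rw [norm_sub_smul_lt_iff (hr.trans hrR).le hu, hp]
  gcongr

theorem inner_pos_of_norm_sub_smul_lt_norm (ht : 0 < t) (h : ‖e - t • w‖ < ‖e‖) :
    0 < ⟪w, e⟫_ℝ := by
  have hsq := pow_lt_pow_left₀ h (norm_nonneg _) two_ne_zero
  rw [norm_sub_sq_real, real_inner_smul_right, real_inner_comm] at hsq
  exact pos_of_mul_pos_right (by linarith [sq_nonneg ‖t • w‖]) ht.le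

theorem two_mul_inner_lt_add_of_norm_sub_smul_lt (hr : 0 ≤ r) (hrR : r ≤ R) (hu : ‖u‖ = 1)
    (hin : ‖p - r • u‖ < r) (hout : r ≤ ‖p - R • u‖) : 2 * ⟪u, p⟫_ℝ < R + r := by
  rw [norm_sub_smul_lt_iff hr hu] at hin
  have hout_sq := pow_le_pow_left₀ hr hout 2
  rw [norm_sub_smul_sq hu] at hout_sq
  have hprod : 0 < (R - r) * (R + r - 2 * ⟪u, p⟫_ℝ) := by linarith
  linarith [pos_of_mul_pos_right hprod (sub_nonneg.2 hrR)]

theorem tendsto_normalize_of_tendsto_smul {ι : Type*} {l : Filter ι} {f : ι → E} (hr : 0 < r)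
    (hu : ‖u‖ = 1) (hf : Tendsto f l (𝓝 (r • u))) :
    Tendsto (fun i => normalize (f i)) l (𝓝 u) := by
  have hne : ‖r • u‖ ≠ 0 := by simp [norm_smul, hu, hr.ne']
  have hlim : Tendsto (fun i => normalize (f i)) l (𝓝 (normalize (r • u))) :=
    (hf.norm.inv₀ hne).smul hf
  rwa [normalize_smul_of_pos hr, normalize_eq_self_of_norm_eq_one hu] at hlim

theorem inner_normalize_pos_iff : 0 < ⟪w, normalize e⟫_ℝ ↔ 0 < ⟪w, e⟫_ℝ := by
  rcases eq_or_ne e 0 with rfl | he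
  · simp
  · rw [NormedSpace.normalize, real_inner_smul_right, mul_pos_iff_of_pos_left (by positivity)]

theorem inner_normalize_le_of_le_norm_sub_smul (hr : 0 < r) (hu : ‖u‖ = 1)
    (hout : r ≤ ‖p - r • u‖) : ⟪u, normalize p⟫_ℝ ≤ ‖p‖ / (2 * r) := by
  rw [le_norm_sub_smul_iff hr.le hu] at hout
  rcases eq_or_ne p 0 with rfl | hp
  · simp
  have hp_pos : 0 < ‖p‖ := norm_pos_iff.2 hp
  rw [NormedSpace.normalize, real_inner_smul_right, le_div_iff₀ (by positivity), inv_mul_eq_div,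
    div_mul_eq_mul_div, div_le_iff₀ hp_pos]
  linarith

theorem inner_nonpos_of_tendsto_normalize {ι : Type*} {l : Filter ι} [l.NeBot] {p : ι → E} {q : E}
    (hr : 0 < r) (hu : ‖u‖ = 1) (hp : Tendsto p l (𝓝 0))
    (hq : Tendsto (fun i => normalize (p i)) l (𝓝 q)) (hout : ∀ i, r ≤ ‖p i - r • u‖) :
    ⟪u, q⟫_ℝ ≤ 0 := by
  have hlim : Tendsto (fun i => ‖p i‖ / (2 * r)) l (𝓝 0) := by
    simpa using hp.norm.div_const (2 * r)
  exact le_of_tendsto_of_tendsto' (tendsto_const_nhds.inner hq) hlim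
    fun i => inner_normalize_le_of_le_norm_sub_smul hr hu (hout i)

/-- The lune cut out of the ball of radius `R` centred at `R • ν` by the ball of the same radius
centred at `R • v`. For unit vectors `v` and `ν` both boundary spheres pass through the origin, and
the points of a set supported at the origin in direction `v` but not in direction `ν` are found in
this lune. -/
def lune (R : ℝ) (v ν : E) : Set E :=
  ball (R • ν) R \ ball (R • v) R

theorem mem_lune {v ν : E} : p ∈ lune R v ν ↔ ‖p - R • ν‖ < R ∧ R ≤ ‖p - R • v‖ := by
  simp [lune, dist_eq_norm]

theorem inner_pos_of_mem_lune {v ν : E} (hR : 0 < R) (hν : ‖ν‖ = 1) (hp : p ∈ lune R v ν) :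
    0 < ⟪ν, p⟫_ℝ := by
  have hlt := (norm_sub_smul_lt_iff hR.le hν).1 (mem_lune.1 hp).1
  exact pos_of_mul_pos_right ((sq_nonneg _).trans_lt hlt) (by positivity)

theorem inner_lt_inner_of_mem_lune {v ν : E} (hR : 0 < R) (hv : ‖v‖ = 1) (hν : ‖ν‖ = 1)
    (hp : p ∈ lune R v ν) : ⟪v, p⟫_ℝ < ⟪ν, p⟫_ℝ := by
  obtain ⟨hin, hout⟩ := mem_lune.1 hp
  rw [norm_sub_smul_lt_iff hR.le hν] at hin
  rw [le_norm_sub_smul_iff hR.le hv] at hout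
  exact lt_of_mul_lt_mul_left (hout.trans_lt hin) (by positivity)

theorem tendsto_inner_normalize_of_mem_lune {ι : Type*} {l : Filter ι} {ν p : ι → E} {v : E}
    (hR : 0 < R) (hv : ‖v‖ = 1) (hν : ∀ i, ‖ν i‖ = 1) (hνlim : Tendsto ν l (𝓝 v))
    (hplim : Tendsto p l (𝓝 0)) (hp : ∀ i, p i ∈ lune R v (ν i)) :
    Tendsto (fun i => ⟪v, normalize (p i)⟫_ℝ) l (𝓝 0) := by
  have hlower : ∀ i, -‖ν i - v‖ ≤ ⟪v, normalize (p i)⟫_ℝ := fun i => by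
    have hpν := inner_pos_of_mem_lune hR (hν i) (hp i)
    have hp0 : p i ≠ 0 := fun h => by simp [h] at hpν
    have hsub : ⟪ν i - v, normalize (p i)⟫_ℝ ≤ ‖ν i - v‖ := by
      simpa [norm_normalize hp0] using real_inner_le_norm (ν i - v) (normalize (p i))
    rw [inner_sub_left] at hsub
    linarith [inner_normalize_pos_iff.2 hpν]
  have hupper : ∀ i, ⟪v, normalize (p i)⟫_ℝ ≤ ‖p i‖ / (2 * R) := fun i =>
    inner_normalize_le_of_le_norm_sub_smul hR hv (mem_lune.1 (hp i)).2
  refine tendsto_of_tendsto_of_tendsto_of_le_of_le ?_ ?_ hlower hupper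
  · simpa using (hνlim.sub_const v).norm.neg
  · simpa using hplim.norm.div_const (2 * R)

theorem norm_sub_smul_eq_of_tendsto_of_mem_lune {ι : Type*} {l : Filter ι} [l.NeBot] {ν p : ι → E}
    {v p₀ : E} (hνlim : Tendsto ν l (𝓝 v)) (hplim : Tendsto p l (𝓝 p₀))
    (hp : ∀ i, p i ∈ lune R v (ν i)) : ‖p₀ - R • v‖ = R :=
  le_antisymm
    (le_of_tendsto' (hplim.sub (hνlim.const_smul R)).norm fun i => (mem_lune.1 (hp i)).1.le)
    (ge_of_tendsto' (hplim.sub_const (R • v)).norm fun i => (mem_lune.1 (hp i)).2)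

end InnerProductSpace

section Plane

variable {E : Type*} [NormedAddCommGroup E] [InnerProductSpace ℝ E]

theorem exists_orthonormalBasis_of_inner_eq_zero (hE : Module.finrank ℝ E = 2) {w v : E}
    (hw : ‖w‖ = 1) (hv : ‖v‖ = 1) (hwv : ⟪w, v⟫_ℝ = 0) :
    ∃ o : OrthonormalBasis (Fin 2) ℝ E, o 0 = w ∧ o 1 = v := by
  have horth : Orthonormal ℝ ![w, v] := by
    simp [orthonormal_iff_ite, Fin.forall_fin_two, hw, hv, hwv, real_inner_comm w v]
  let b := basisOfOrthonormalOfCardEqFinrank horth (by simp [hE])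
  have hb : ⇑b = ![w, v] := coe_basisOfOrthonormalOfCardEqFinrank horth _
  exact ⟨b.toOrthonormalBasis (hb ▸ horth), by simp [hb], by simp [hb]⟩

variable (o : OrthonormalBasis (Fin 2) ℝ E) {p e ν : E} {R t : ℝ}

theorem inner_eq_add_mul_inner (p q : E) :
    ⟪p, q⟫_ℝ = ⟪o 0, p⟫_ℝ * ⟪o 0, q⟫_ℝ + ⟪o 1, p⟫_ℝ * ⟪o 1, q⟫_ℝ := by
  simpa [Fin.sum_univ_two, real_inner_comm p] using (o.sum_inner_mul_inner p q).symm

theorem norm_sq_eq_add_sq_inner (p : E) : ‖p‖ ^ 2 = ⟪o 0, p⟫_ℝ ^ 2 + ⟪o 1, p⟫_ℝ ^ 2 := by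
  simpa [Fin.sum_univ_two] using (o.sum_sq_norm_inner_right p).symm

theorem inner_basis_zero_pos_of_mem_lune (hR : 0 < R) (hν : ‖ν‖ = 1) (hν0 : 0 < ⟪o 0, ν⟫_ℝ)
    (hν1 : 0 < ⟪o 1, ν⟫_ℝ) (hp : p ∈ lune R (o 1) ν) : 0 < ⟪o 0, p⟫_ℝ := by
  have hpν : 0 < ⟪ν, p⟫_ℝ := inner_pos_of_mem_lune hR hν hp
  have hlt : ⟪o 1, p⟫_ℝ < ⟪ν, p⟫_ℝ := inner_lt_inner_of_mem_lune hR (o.norm_eq_one 1) hν hp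
  have hν1_le : ⟪o 1, ν⟫_ℝ ≤ 1 := by
    simpa [hν] using real_inner_le_norm (o 1) ν
  -- `⟪o 0, ν⟫ * ⟪o 0, p⟫` is a convex combination of two positive numbers.
  have hcomb : ⟪o 0, ν⟫_ℝ * ⟪o 0, p⟫_ℝ = (1 - ⟪o 1, ν⟫_ℝ) * ⟪ν, p⟫_ℝ
      + ⟪o 1, ν⟫_ℝ * (⟪ν, p⟫_ℝ - ⟪o 1, p⟫_ℝ) := by
    rw [inner_eq_add_mul_inner o ν p]
    ring
  refine pos_of_mul_pos_right ?_ hν0.le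
  rw [hcomb]
  exact add_pos_of_nonneg_of_pos (mul_nonneg (sub_nonneg.2 hν1_le) hpν.le)
    (mul_pos hν1 (sub_pos.2 hlt))

theorem eventually_inner_basis_zero_pos_of_mem_lune {ι : Type*} {l : Filter ι} {ν p : ι → E}
    (hR : 0 < R) (hν : ∀ i, ‖ν i‖ = 1) (hν0 : ∀ i, 0 < ⟪o 0, ν i⟫_ℝ)
    (hνlim : Tendsto ν l (𝓝 (o 1))) (hp : ∀ i, p i ∈ lune R (o 1) (ν i)) :
    ∀ᶠ i in l, 0 < ⟪o 0, p i⟫_ℝ := by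
  have hν1 : Tendsto (fun i => ⟪o 1, ν i⟫_ℝ) l (𝓝 1) := by
    simpa using tendsto_const_nhds.inner (𝕜 := ℝ) (f := fun _ => o 1) hνlim
  filter_upwards [hν1.eventually_const_lt one_pos] with i hi
  exact inner_basis_zero_pos_of_mem_lune o hR (hν i) (hν0 i) hi (hp i)

theorem tendsto_basis_zero_of_tendsto_inner_basis_one {ι : Type*} {l : Filter ι} {q : ι → E}
    (hq : ∀ᶠ i in l, ‖q i‖ = 1) (hq0 : ∀ᶠ i in l, 0 ≤ ⟪o 0, q i⟫_ℝ)
    (hq1 : Tendsto (fun i => ⟪o 1, q i⟫_ℝ) l (𝓝 0)) : Tendsto q l (𝓝 (o 0)) := by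
  have hsqrt : Tendsto (fun i => √(1 - ⟪o 1, q i⟫_ℝ ^ 2)) l (𝓝 1) := by
    simpa using ((hq1.pow 2).const_sub 1).sqrt
  have hq0lim : Tendsto (fun i => ⟪o 0, q i⟫_ℝ) l (𝓝 1) := by
    refine hsqrt.congr' ?_
    filter_upwards [hq, hq0] with i hi hi0
    have hsq := norm_sq_eq_add_sq_inner o (q i)
    rw [hi, one_pow] at hsq
    rw [hsq, add_sub_cancel_right, Real.sqrt_sq hi0]
  have hlim := (hq0lim.smul_const (o 0)).add (hq1.smul_const (o 1))
  rw [one_smul, zero_smul, add_zero] at hlim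
  refine hlim.congr fun i => ?_
  simpa [Fin.sum_univ_two] using o.sum_repr' (q i)

theorem tendsto_normalize_of_mem_lune {ι : Type*} {l : Filter ι} {ν p : ι → E} (hR : 0 < R)
    (hν : ∀ i, ‖ν i‖ = 1) (hν0 : ∀ i, 0 < ⟪o 0, ν i⟫_ℝ) (hνlim : Tendsto ν l (𝓝 (o 1)))
    (hplim : Tendsto p l (𝓝 0)) (hp : ∀ i, p i ∈ lune R (o 1) (ν i)) :
    Tendsto (fun i => normalize (p i)) l (𝓝 (o 0)) := by
  have hp0 := eventually_inner_basis_zero_pos_of_mem_lune o hR hν hν0 hνlim hp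
  refine tendsto_basis_zero_of_tendsto_inner_basis_one o (hp0.mono fun i hi => norm_normalize ?_)
    (hp0.mono fun i hi => (inner_normalize_pos_iff.2 hi).le)
    (tendsto_inner_normalize_of_mem_lune hR (o.norm_eq_one 1) hν hνlim hplim hp)
  intro h
  simp [h] at hi

theorem eq_zero_of_norm_sub_smul_eq (hR : 0 < R) (hp : ‖p - R • o 1‖ = R)
    (hp0 : ⟪o 0, p⟫_ℝ = 0) (hp1 : ⟪o 1, p⟫_ℝ < 2 * R) : p = 0 := by
  rw [norm_sub_smul_eq_iff hR.le (o.norm_eq_one 1)] at hp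
  have hnorm := norm_sq_eq_add_sq_inner o p
  rw [hp0] at hnorm
  have hprod : ⟪o 1, p⟫_ℝ * (⟪o 1, p⟫_ℝ - 2 * R) = 0 := by linarith
  have hp1_zero : ⟪o 1, p⟫_ℝ = 0 :=
    (mul_eq_zero.1 hprod).resolve_right (by linarith)
  simpa [hp1_zero] using hnorm

theorem inner_basis_zero_lt_of_le_norm_sub (hR : 0 < R) (ht : 0 < t) (heR : R ≤ ‖e‖)
    (he1 : 0 < ⟪o 1, e⟫_ℝ) (hte : ‖e - t • o 0‖ < R) (hp : ‖p - R • o 1‖ = R)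
    (hpe : R ≤ ‖p - e‖) : ⟪o 0, p⟫_ℝ < t + ⟪o 1, p⟫_ℝ * (⟪o 0, e⟫_ℝ / R) := by
  have he0 : 0 < ⟪o 0, e⟫_ℝ := inner_pos_of_norm_sub_smul_lt_norm ht (hte.trans_le heR)
  rw [norm_sub_smul_eq_iff hR.le (o.norm_eq_one 1)] at hp
  have hp1 : 0 ≤ ⟪o 1, p⟫_ℝ := nonneg_of_mul_nonneg_right (hp ▸ sq_nonneg ‖p‖) (by positivity)
  have hfar := pow_le_pow_left₀ hR.le hpe 2
  rw [norm_sub_sq_real, inner_eq_add_mul_inner o p e] at hfar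
  have hnear := pow_lt_pow_left₀ hte (norm_nonneg _) two_ne_zero
  rw [norm_sub_smul_sq (o.norm_eq_one 0)] at hnear
  have hsagitta : R - ⟪o 1, e⟫_ℝ ≤ ⟪o 0, e⟫_ℝ * (⟪o 0, e⟫_ℝ / R) := by
    have he_sq := pow_le_pow_left₀ hR.le heR 2
    rw [norm_sq_eq_add_sq_inner o e] at he_sq
    rw [← mul_div_assoc, le_div_iff₀ hR]
    nlinarith
  refine lt_of_mul_lt_mul_left ?_ he0.le
  calc ⟪o 0, e⟫_ℝ * ⟪o 0, p⟫_ℝ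
      < ⟪o 0, e⟫_ℝ * t + ⟪o 1, p⟫_ℝ * (R - ⟪o 1, e⟫_ℝ) := by linarith [sq_nonneg t]
    _ ≤ ⟪o 0, e⟫_ℝ * t + ⟪o 1, p⟫_ℝ * (⟪o 0, e⟫_ℝ * (⟪o 0, e⟫_ℝ / R)) := by gcongr
    _ = ⟪o 0, e⟫_ℝ * (t + ⟪o 1, p⟫_ℝ * (⟪o 0, e⟫_ℝ / R)) := by ring

section Limit

variable {ι : Type*} {l : Filter ι} [l.NeBot] {t : ι → ℝ} {e p : ι → E} {p₀ : E}

theorem inner_basis_zero_nonpos_of_le_norm_sub (hR : 0 < R) (ht : ∀ i, 0 < t i)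
    (htlim : Tendsto t l (𝓝 0)) (helim : Tendsto e l (𝓝 (R • o 1))) (heR : ∀ i, R ≤ ‖e i‖)
    (hte : ∀ i, ‖e i - t i • o 0‖ < R) (hp₀ : ‖p₀ - R • o 1‖ = R)
    (hp₀e : ∀ i, R ≤ ‖p₀ - e i‖) : ⟪o 0, p₀⟫_ℝ ≤ 0 := by
  have he0 : Tendsto (fun i => ⟪o 0, e i⟫_ℝ) l (𝓝 0) := by
    simpa [real_inner_smul_right, o.inner_eq_ite] using
      tendsto_const_nhds.inner (𝕜 := ℝ) (f := fun _ => o 0) helim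
  have he1 : Tendsto (fun i => ⟪o 1, e i⟫_ℝ) l (𝓝 R) := by
    simpa [real_inner_smul_right] using
      tendsto_const_nhds.inner (𝕜 := ℝ) (f := fun _ => o 1) helim
  have hbound : Tendsto (fun i => t i + ⟪o 1, p₀⟫_ℝ * (⟪o 0, e i⟫_ℝ / R)) l (𝓝 0) := by
    simpa using htlim.add ((he0.div_const R).const_mul ⟪o 1, p₀⟫_ℝ)
  refine ge_of_tendsto hbound ?_
  filter_upwards [he1.eventually_const_lt hR] with i hi
  exact (inner_basis_zero_lt_of_le_norm_sub o hR (ht i) (heR i) hi (hte i) hp₀ (hp₀e i)).le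

theorem eq_zero_of_tendsto_of_mem_lune (hR : 0 < R) (ht : ∀ i, 0 < t i)
    (htlim : Tendsto t l (𝓝 0)) (helim : Tendsto e l (𝓝 (R • o 1))) (heR : ∀ i, R ≤ ‖e i‖)
    (hte : ∀ i, ‖e i - t i • o 0‖ < R) (hplim : Tendsto p l (𝓝 p₀))
    (hp : ∀ i, p i ∈ lune R (o 1) (normalize (e i))) (hpe : ∀ i, R ≤ ‖p i - e i‖)
    (hp₀e : ∀ i, R ≤ ‖p₀ - e i‖) : p₀ = 0 := by
  have hν : ∀ i, ‖normalize (e i)‖ = 1 := fun i =>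
    norm_normalize (norm_pos_iff.1 (hR.trans_le (heR i)))
  have hν0 : ∀ i, 0 < ⟪o 0, normalize (e i)⟫_ℝ := fun i =>
    inner_normalize_pos_iff.2 (inner_pos_of_norm_sub_smul_lt_norm (ht i) ((hte i).trans_le (heR i)))
  have hνlim : Tendsto (fun i => normalize (e i)) l (𝓝 (o 1)) :=
    tendsto_normalize_of_tendsto_smul hR (o.norm_eq_one 1) helim
  have hcircle : ‖p₀ - R • o 1‖ = R := norm_sub_smul_eq_of_tendsto_of_mem_lune hνlim hplim hp
  have hp₀0_le : ⟪o 0, p₀⟫_ℝ ≤ 0 :=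
    inner_basis_zero_nonpos_of_le_norm_sub o hR ht htlim helim heR hte hcircle hp₀e
  have hp₀0_ge : 0 ≤ ⟪o 0, p₀⟫_ℝ := ge_of_tendsto (tendsto_const_nhds.inner hplim)
    ((eventually_inner_basis_zero_pos_of_mem_lune o hR hν hν0 hνlim hp).mono fun _ h => h.le)
  have hp₀1 : 2 * ⟪o 1, p₀⟫_ℝ ≤ ‖R • o 1‖ + R := by
    refine le_of_tendsto_of_tendsto' ((hνlim.inner hplim).const_mul 2) (helim.norm.add_const R)
      fun i => (two_mul_inner_lt_add_of_norm_sub_smul_lt hR.le (heR i) (hν i)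
        (mem_lune.1 (hp i)).1 ?_).le
    rw [norm_smul_normalize]
    exact hpe i
  rw [norm_smul, o.norm_eq_one, mul_one, Real.norm_of_nonneg hR.le] at hp₀1
  exact eq_zero_of_norm_sub_smul_eq o hR hcircle (le_antisymm hp₀0_le hp₀0_ge) (by linarith)

end Limit

end Plane

section Body

variable {d : ℕ} {A : Set (EuclideanSpace ℝ (Fin d))} {a u v w : EuclideanSpace ℝ (Fin d)}
  {r R : ℝ}

theorem ball_add_subset_compl_iff {e : EuclideanSpace ℝ (Fin d)} :
    ball (a + e) R ⊆ Aᶜ ↔ ∀ p, a + p ∈ A → R ≤ ‖p - e‖ := by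
  rw [Set.subset_compl_comm, Set.subset_def, (Equiv.addLeft a).surjective.forall]
  simp [dist_eq_norm]

theorem mem_supportingVectors_iff :
    v ∈ supportingVectors R A a ↔ ‖v‖ = 1 ∧ ∀ p, a + p ∈ A → R ≤ ‖p - R • v‖ := by
  rw [← ball_add_subset_compl_iff, Set.subset_compl_comm]
  simp [supportingVectors]

theorem isCompact_supportingVectors (R : ℝ) (A : Set (EuclideanSpace ℝ (Fin d)))
    (a : EuclideanSpace ℝ (Fin d)) : IsCompact (supportingVectors R A a) := by
  have heq : supportingVectors R A a =
      sphere 0 1 ∩ ⋂ (p) (_ : a + p ∈ A), {v | R ≤ ‖p - R • v‖} := by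
    ext v
    simp [mem_supportingVectors_iff]
  rw [heq]
  exact (isCompact_sphere 0 1).inter_right <| isClosed_biInter fun p _ =>
    isClosed_le continuous_const (by fun_prop)

theorem add_smul_notMem_of_mem_supportingVectors (hr : 0 ≤ r) (hu : u ∈ supportingVectors r A a)
    (hw : ‖w‖ = 1) {t : ℝ} (ht : 0 < t) (htr : t < 2 * r * ⟪u, w⟫_ℝ) : a + t • w ∉ A := by
  rw [mem_supportingVectors_iff] at hu
  intro hmem
  have hout := (le_norm_sub_smul_iff hr hu.1).1 (hu.2 _ hmem)
  rw [real_inner_smul_right, norm_smul, hw, mul_one, Real.norm_of_nonneg ht.le] at hout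
  nlinarith

theorem exists_supportingVector_tendsto_smul (hR : 0 < R) (hA : IsRBody R A) (ha : a ∈ A)
    {z : ℕ → EuclideanSpace ℝ (Fin d)} (hz : Tendsto z atTop (𝓝 0)) (hzA : ∀ n, a + z n ∉ A) :
    ∃ v ∈ supportingVectors R A a, ∃ φ : ℕ → ℕ, StrictMono φ ∧
      ∃ e : ℕ → EuclideanSpace ℝ (Fin d), Tendsto e atTop (𝓝 (R • v)) ∧
        ∀ n, ‖e n - z (φ n)‖ < R ∧ ball (a + e n) R ⊆ Aᶜ := by
  have hcenter : ∀ n, ∃ e, ‖e - z n‖ < R ∧ ball (a + e) R ⊆ Aᶜ := fun n => by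
    obtain ⟨c, hc, hcA⟩ := hA.2 _ (hzA n)
    refine ⟨c - a, ?_, by rwa [add_sub_cancel]⟩
    rwa [mem_ball', dist_eq_norm, ← sub_sub] at hc
  choose e hez heA using hcenter
  have hbdd : ∀ n, e n ∈ thickening R (Set.range z) := fun n =>
    mem_thickening_iff.2 ⟨z n, Set.mem_range_self n, by rw [dist_eq_norm]; exact hez n⟩
  obtain ⟨e₀, -, φ, hφ, helim⟩ :=
    tendsto_subseq_of_bounded (isBounded_range_of_tendsto z hz).thickening hbdd
  have he₀A : ∀ p, a + p ∈ A → R ≤ ‖p - e₀‖ := fun p hp =>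
    ge_of_tendsto' (helim.const_sub p).norm fun n => ball_add_subset_compl_iff.1 (heA (φ n)) p hp
  have he₀ : ‖e₀‖ = R := by
    refine le_antisymm ?_ (by simpa using he₀A 0 (by simpa using ha))
    have hlim := (helim.sub (hz.comp hφ.tendsto_atTop)).norm
    rw [sub_zero] at hlim
    exact le_of_tendsto' hlim fun n => (hez (φ n)).le
  have hsmul : R • normalize e₀ = e₀ := he₀ ▸ norm_smul_normalize e₀
  refine ⟨normalize e₀, mem_supportingVectors_iff.2 ⟨norm_normalize ?_, by rwa [hsmul]⟩,
    φ, hφ, e ∘ φ, by rwa [hsmul], fun n => ⟨hez _, heA _⟩⟩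
  exact norm_pos_iff.1 (he₀ ▸ hR)

theorem exists_tendsto_mem_lune_of_notMem_supportingVectors (hA : IsClosed A)
    (hv : v ∈ supportingVectors R A a) {ν : ℕ → EuclideanSpace ℝ (Fin d)}
    (hν : ∀ n, ‖ν n‖ = 1) (hνN : ∀ n, ν n ∉ supportingVectors R A a) :
    ∃ p₀, a + p₀ ∈ A ∧ ∃ ψ : ℕ → ℕ, StrictMono ψ ∧
      ∃ p : ℕ → EuclideanSpace ℝ (Fin d), Tendsto p atTop (𝓝 p₀) ∧
        ∀ n, a + p n ∈ A ∧ p n ∈ lune R v (ν (ψ n)) := by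
  have hblock : ∀ n, ∃ p, a + p ∈ A ∧ p ∈ lune R v (ν n) := fun n => by
    by_contra! hcon
    refine hνN n (mem_supportingVectors_iff.2 ⟨hν n, fun p hp => not_lt.1 fun hlt => ?_⟩)
    exact hcon p hp (mem_lune.2 ⟨hlt, (mem_supportingVectors_iff.1 hv).2 p hp⟩)
  choose p hpA hp using hblock
  have hbdd : ∀ n, p n ∈ ball (0 : EuclideanSpace ℝ (Fin d)) R + closedBall 0 |R| := fun n =>
    Set.mem_add.2 ⟨p n - R • ν n, by simpa using (mem_lune.1 (hp n)).1, R • ν n,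
      by simp [norm_smul, hν], sub_add_cancel _ _⟩
  obtain ⟨p₀, -, ψ, hψ, hplim⟩ :=
    tendsto_subseq_of_bounded (isBounded_ball.add isBounded_closedBall) hbdd
  exact ⟨p₀, hA.mem_of_tendsto (hplim.const_add a) (.of_forall fun n => hpA _), ψ, hψ, p ∘ ψ,
    hplim, fun n => ⟨hpA _, hp _⟩⟩

end Body

section SphericallyConvex

variable {d : ℕ} {K : Set (EuclideanSpace ℝ (Fin d))}

theorem smul_mem_relatedCone {x : EuclideanSpace ℝ (Fin d)} {t : ℝ} (ht : 0 ≤ t)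
    (hx : x ∈ relatedCone K) : t • x ∈ relatedCone K := by
  obtain ⟨v, hv, s, hs, rfl⟩ := hx
  exact ⟨v, hv, t * s, by positivity, smul_smul t s v⟩

theorem zero_mem_relatedCone (hK : K.Nonempty) : 0 ∈ relatedCone K := by
  obtain ⟨v, hv⟩ := hK
  exact ⟨v, hv, 0, le_rfl, (zero_smul ℝ v).symm⟩

theorem subset_relatedCone : K ⊆ relatedCone K := fun v hv =>
  ⟨v, hv, 1, zero_le_one, (one_smul ℝ v).symm⟩

theorem smul_mem_convexHull_relatedCone {x : EuclideanSpace ℝ (Fin d)} {t : ℝ} (ht : 0 ≤ t)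
    (hx : x ∈ convexHull ℝ (relatedCone K)) : t • x ∈ convexHull ℝ (relatedCone K) := by
  have hmem := Set.smul_mem_smul_set (a := t) hx
  rw [← convexHull_smul] at hmem
  refine convexHull_mono ?_ hmem
  rintro _ ⟨y, hy, rfl⟩
  exact smul_mem_relatedCone ht hy

theorem convex_relatedCone (hK : IsSphericallyConvex K) (hne : K.Nonempty) :
    Convex ℝ (relatedCone K) := by
  refine convexHull_eq_self.1 (Set.Subset.antisymm (fun x hx => ?_) (subset_convexHull ℝ _))
  rcases eq_or_ne x 0 with rfl | hx0
  · exact zero_mem_relatedCone hne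
  · refine ⟨normalize x, hK ▸ ⟨?_, ?_⟩, ‖x‖, norm_nonneg x, (norm_smul_normalize x).symm⟩
    · exact smul_mem_convexHull_relatedCone (by positivity) hx
    · rw [mem_sphere_zero_iff_norm, norm_normalize hx0]

theorem isClosed_relatedCone (hK : IsCompact K) (hsub : K ⊆ sphere 0 1) :
    IsClosed (relatedCone K) := by
  have heq : relatedCone K =
      Prod.fst '' {z : EuclideanSpace ℝ (Fin d) × K | z.1 = ‖z.1‖ • z.2} := by
    ext x
    constructor
    · rintro ⟨v, hv, t, ht, rfl⟩
      refine ⟨(t • v, ⟨v, hv⟩), ?_, rfl⟩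
      simp [norm_smul, mem_sphere_zero_iff_norm.1 (hsub hv), abs_of_nonneg ht]
    · rintro ⟨⟨x, v⟩, hx, rfl⟩
      exact ⟨v, v.2, ‖x‖, norm_nonneg x, hx⟩
  have : CompactSpace K := isCompact_iff_compactSpace.1 hK
  rw [heq]
  exact isClosedMap_fst_of_compactSpace _ (isClosed_eq (by fun_prop) (by fun_prop))

theorem exists_unit_inner_pos_of_notMem (hK : IsCompact K) (hsub : K ⊆ sphere 0 1)
    (hconv : IsSphericallyConvex K) (hne : K.Nonempty) {u : EuclideanSpace ℝ (Fin d)}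
    (hu : ‖u‖ = 1) (huK : u ∉ K) :
    ∃ w : EuclideanSpace ℝ (Fin d), ‖w‖ = 1 ∧ 0 < ⟪w, u⟫_ℝ ∧ ∀ v ∈ K, ⟪w, v⟫_ℝ ≤ 0 := by
  have hu_cone : u ∉ relatedCone K := fun h =>
    huK (hconv ▸ ⟨subset_convexHull ℝ _ h, mem_sphere_zero_iff_norm.2 hu⟩)
  obtain ⟨f, α, hf, hfu⟩ := geometric_hahn_banach_closed_point (convex_relatedCone hconv hne)
    (isClosed_relatedCone hK hsub) hu_cone
  have hα : 0 < α := by simpa using hf 0 (zero_mem_relatedCone hne)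
  have hf_nonpos : ∀ v ∈ K, f v ≤ 0 := fun v hv => by
    by_contra! hpos
    have := hf _ (smul_mem_relatedCone (t := α / f v) (by positivity) (subset_relatedCone hv))
    simp [hpos.ne'] at this
  obtain ⟨w, rfl⟩ := (InnerProductSpace.toDual ℝ (EuclideanSpace ℝ (Fin d))).surjective f
  simp only [InnerProductSpace.toDual_apply_apply] at hfu hf_nonpos
  have hwu : 0 < ⟪w, u⟫_ℝ := hα.trans hfu
  have hw : w ≠ 0 := fun h => by simp [h] at hwu
  refine ⟨normalize w, norm_normalize hw, ?_, fun v hv => ?_⟩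
  · rw [real_inner_comm, inner_normalize_pos_iff, real_inner_comm]
    exact hwu
  · rw [← not_lt, real_inner_comm, inner_normalize_pos_iff, real_inner_comm, not_lt]
    exact hf_nonpos v hv

end SphericallyConvex

section PlanarBody

variable {A : Set (EuclideanSpace ℝ (Fin 2))} {a u w : EuclideanSpace ℝ (Fin 2)} {r R : ℝ}

theorem exists_supportingVector_inner_pos (hR : 0 < R) (hA : IsRBody R A) (ha : a ∈ A)
    (hr : 0 < r) (hu : u ∈ supportingVectors r A a) (hw : ‖w‖ = 1) (hwu : 0 < ⟪u, w⟫_ℝ) :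
    ∃ v ∈ supportingVectors R A a, 0 < ⟪w, v⟫_ℝ := by
  by_contra! hN
  obtain ⟨t, -, ht, htlim⟩ :=
    exists_seq_strictAnti_tendsto' (show 0 < 2 * r * ⟪u, w⟫_ℝ by positivity)
  obtain ⟨v, hv, φ, hφ, e, helim, he⟩ := exists_supportingVector_tendsto_smul hR hA ha
    (z := fun n => t n • w) (by simpa using htlim.smul_const w)
    fun n => add_smul_notMem_of_mem_supportingVectors hr.le hu hw (ht n).1 (ht n).2
  have hv_unit : ‖v‖ = 1 := (mem_supportingVectors_iff.1 hv).1
  have heA : ∀ n p, a + p ∈ A → R ≤ ‖p - e n‖ := fun n => ball_add_subset_compl_iff.1 (he n).2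
  have heR : ∀ n, R ≤ ‖e n‖ := fun n => by simpa using heA n 0 (by simpa using ha)
  have hwe : ∀ n, 0 < ⟪w, e n⟫_ℝ := fun n =>
    inner_pos_of_norm_sub_smul_lt_norm (ht (φ n)).1 ((he n).1.trans_le (heR n))
  have hwv : ⟪w, v⟫_ℝ = 0 := by
    refine le_antisymm (hN v hv) ?_
    have := ge_of_tendsto' (tendsto_const_nhds.inner helim) fun n => (hwe n).le
    rw [real_inner_smul_right] at this
    exact nonneg_of_mul_nonneg_right this hR
  obtain ⟨o, rfl, rfl⟩ := exists_orthonormalBasis_of_inner_eq_zero (by simp) hw hv_unit hwv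
  have hν : ∀ n, ‖normalize (e n)‖ = 1 := fun n =>
    norm_normalize (norm_pos_iff.1 (hR.trans_le (heR n)))
  have hν0 : ∀ n, 0 < ⟪o 0, normalize (e n)⟫_ℝ := fun n => inner_normalize_pos_iff.2 (hwe n)
  obtain ⟨p₀, hp₀A, ψ, hψ, p, hplim, hp⟩ := exists_tendsto_mem_lune_of_notMem_supportingVectors
    hA.1.2 hv hν fun n hmem => (hN _ hmem).not_gt (hν0 n)
  have helim' := helim.comp hψ.tendsto_atTop
  obtain rfl : p₀ = 0 := eq_zero_of_tendsto_of_mem_lune o hR (fun n => (ht (φ (ψ n))).1)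
    (htlim.comp (hφ.comp hψ).tendsto_atTop) helim' (fun n => heR (ψ n)) (fun n => (he (ψ n)).1)
    hplim (fun n => (hp n).2) (fun n => heA _ _ (hp n).1) (fun n => heA _ _ hp₀A)
  have hdir : Tendsto (fun n => normalize (p n)) atTop (𝓝 (o 0)) :=
    tendsto_normalize_of_mem_lune o hR (fun n => hν (ψ n)) (fun n => hν0 (ψ n))
      (tendsto_normalize_of_tendsto_smul hR hv_unit helim') hplim fun n => (hp n).2
  rw [mem_supportingVectors_iff] at hu
  exact (inner_nonpos_of_tendsto_normalize hr hu.1 hplim hdir fun n => hu.2 _ (hp n).1).not_gt hwu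

theorem supportingVectors_subset_of_isSphericallyConvex (hR : 0 < R) (hA : IsRBody R A)
    (ha : a ∈ A) (hconv : IsSphericallyConvex (supportingVectors R A a)) (hr : 0 < r) :
    supportingVectors r A a ⊆ supportingVectors R A a := by
  intro u hu
  have hu_unit : ‖u‖ = 1 := (mem_supportingVectors_iff.1 hu).1
  by_contra hmem
  obtain ⟨v₀, hv₀, -⟩ := exists_supportingVector_inner_pos hR hA ha hr hu hu_unit
    (by simp [hu_unit])
  obtain ⟨w, hw, hwu, hwN⟩ := exists_unit_inner_pos_of_notMem (isCompact_supportingVectors R A a)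
    (fun v hv => hv.1) hconv ⟨v₀, hv₀⟩ hu_unit hmem
  obtain ⟨v, hv, hpos⟩ := exists_supportingVector_inner_pos hR hA ha hr hu hw
    (real_inner_comm w u ▸ hwu)
  exact (hwN v hv).not_gt hpos

end PlanarBody

section Reach

variable {d : ℕ} {A : Set (EuclideanSpace ℝ (Fin d))} {b x : EuclideanSpace ℝ (Fin d)} {R : ℝ}

theorem mem_frontier_of_dist_eq_infDist (hb : b ∈ A) (hbx : dist b x = infDist x A)
    (hpos : 0 < infDist x A) : b ∈ frontier A := by
  rw [frontier_eq_closure_inter_closure]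
  refine ⟨subset_closure hb, closure_mono (disjoint_ball_infDist (x := x)).subset_compl_right ?_⟩
  rw [closure_ball x hpos.ne', mem_closedBall, hbx]

theorem normalize_sub_mem_supportingVectors (hbx : dist b x = infDist x A)
    (hpos : 0 < infDist x A) : normalize (x - b) ∈ supportingVectors (infDist x A) A b := by
  have hnorm : ‖x - b‖ = infDist x A := by rw [← hbx, dist_eq_norm']
  refine ⟨?_, ?_⟩
  · rw [mem_sphere_zero_iff_norm, norm_normalize (norm_pos_iff.1 (hnorm ▸ hpos))]
  · nth_rw 1 [← hnorm]
    rw [norm_smul_normalize, add_sub_cancel]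
    exact disjoint_ball_infDist.subset_compl_left

theorem eq_of_dist_eq_infDist {b' : EuclideanSpace ℝ (Fin d)} (hb' : b' ∈ A)
    (hbx : dist b x = infDist x A) (hbx' : dist b' x = infDist x A) (hpos : 0 < infDist x A)
    (hlt : infDist x A < R)
    (hsub : supportingVectors (infDist x A) A b ⊆ supportingVectors R A b) : b' = b := by
  by_contra hne
  have hmem := normalize_sub_mem_supportingVectors hbx hpos
  have hsmul : infDist x A • normalize (x - b) = x - b := by
    rw [← hbx, dist_eq_norm', norm_smul_normalize]
  have hunit : ‖normalize (x - b)‖ = 1 := (mem_supportingVectors_iff.1 hmem).1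
  refine ((mem_supportingVectors_iff.1 (hsub hmem)).2 (b' - b) (by simpa using hb')).not_gt ?_
  refine norm_sub_smul_lt_of_internally_tangent hpos hlt hunit (sub_ne_zero.2 hne) ?_
  rw [hsmul, sub_sub_sub_cancel_right, ← dist_eq_norm, hbx']

theorem mem_unp_of_infDist_lt (hA : IsBody A) (hlt : infDist x A < R)
    (hsub : ∀ a ∈ frontier A, ∀ r, 0 < r → supportingVectors r A a ⊆ supportingVectors R A a) :
    x ∈ unp A := by
  obtain ⟨b, hb, hbx⟩ := hA.2.exists_infDist_eq_dist hA.1 x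
  rw [dist_comm] at hbx
  refine ⟨b, ⟨hb, hbx.symm⟩, fun b' ⟨hb', hbx'⟩ => ?_⟩
  rcases (infDist_nonneg (x := x) (s := A)).eq_or_lt with hzero | hpos
  · rw [← hzero, dist_eq_zero] at hbx'
    rw [← hzero, eq_comm, dist_eq_zero] at hbx
    exact hbx'.trans hbx.symm
  · exact eq_of_dist_eq_infDist hb' hbx.symm hbx' hpos hlt
      (hsub b (mem_frontier_of_dist_eq_infDist hb hbx.symm hpos) _ hpos)

theorem le_reach_of_supportingVectors_subset (hR : 0 < R) (hA : IsBody A)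
    (hsub : ∀ a ∈ frontier A, ∀ r, 0 < r → supportingVectors r A a ⊆ supportingVectors R A a) :
    ENNReal.ofReal R ≤ reach A :=
  le_iInf₂ fun _ ha => le_sSup ⟨R, hR, fun _ hx =>
    mem_unp_of_infDist_lt hA ((infDist_le_dist_of_mem ha).trans_lt hx) hsub, rfl⟩

end Reach

end RBodies

theorem mainTheorem2 (R : ℝ) (hR : 0 < R) (A : Set (EuclideanSpace ℝ (Fin 2)))
    (hA : RBodies.IsRBody R A)
    (hconv : ∀ a ∈ frontier A, RBodies.IsSphericallyConvex (RBodies.supportingVectors R A a)) :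
    ENNReal.ofReal R ≤ RBodies.reach A :=
  RBodies.le_reach_of_supportingVectors_subset hR hA.1 fun a ha _ hr =>
    RBodies.supportingVectors_subset_of_isSphericallyConvex hR hA (hA.1.2.frontier_subset ha)
      (hconv a ha) hr
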